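/- Let $(\Omega,\mathcal A,\mu)$ be a measure space with $0<\mu(\Omega)<\infty$, let $\mathcal H$ be a real Hilbert space, let $f\in L^2(\Omega;\mathcal H)$ (Lebesgue--Bochner space) and let $k\ge 0$ be an integer. Put $$d_k^{(2)}(f)=\inf\big\{\|f-g\|_{L^2(\Omega;\mathcal H)} : \mathcal U\subseteq\mathcal H \text{ a subspace of dimension at most } k,\ g\in L^2(\Omega;\mathcal U)\big\}$$ (if $\dim\mathcal H\ge k$, one may equivalently require dimension exactly $k$). A Schmidt decomposition of $f$ is an expansion $f=\sum_{i=1}^r\sigma_iu_iv_i$, converging in $L^2(\Omega;\mathcal H)$, with $r\in\mathbb N\cup\{0,\infty\}$, orthonormal systems $(u_i)_{i=1}^r$ in $\mathcal H$ and $(v_i)_{i=1}^r$ in $L^2(\Omega)$, and real numbers $\sigma_1\ge\sigma_2\ge\dots$ with $\sigma_i>0$ for $i=1,\dots,r$; the $\sigma_i$ are the singular values of $f$, and $\sigma_i:=0$ for $i>r$. Such a decomposition exists, and $d_k^{(2)}(f)^2=\sum_{i>k}\sigma_i^2$ for its singular values. There exists a set $\hat{\mathbf\Omega}\subseteq\Omega^k$,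 measurable for the product $\sigma$-algebra and of positive product measure $\mu^{\otimes k}$, such that for every function $\Omega\to\mathcal H$ representing the class $f$ (again denoted by $f$) and for $\mu^{\otimes k}$-almost every $\mathbf y=(y_1,\dots,y_k)\in\hat{\mathbf\Omega}$, $$d_k^{(2)}(f)\le\|f-\Pi_{\mathbf y}f\|_{L^2(\Omega;\mathcal H)}\le\sqrt{k+1}\; d_k^{(2)}(f),$$ where $\Pi_{\mathbf y}$ is the orthogonal projection of $\mathcal H$ onto $\mathrm{span}\{f(y_1),\dots,f(y_k)\}$; equivalently to the upper bound, $\|f-\Pi_{\mathbf y}f\|^2_{L^2(\Omega;\mathcal H)}\le(k+1)\sum_{i>k}\sigma_i^2$. The set $\hat{\mathbf\Omega}$ does not depend on the representative, and the case where the rank $r$ of $f$ is less than $k$ is included. -/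

import Mathlib

open MeasureTheory
open scoped ENNReal

noncomputable section

/-- The average Kolmogorov width `d_k^{(p)}(f)`: the infimum of `‖f - g‖` in `L^p(Ω; H)` over all
subspaces `U` of `H` of dimension at most `k` and all `g ∈ L^p(Ω; U)`. Whenever `H` has a subspace of
dimension `k`, this is the infimum over subspaces of dimension exactly `k`
(`avgWidth_eq_sInf_finrank_eq`). The set is nonempty (take `U = 0`) and bounded below by `0`. -/
def avgWidth {Ω : Type*} [MeasurableSpace Ω] {μ : Measure Ω}
    {H : Type*} [NormedAddCommGroup H] [InnerProductSpace ℝ H] {p : ℝ≥0∞}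
    (k : ℕ) (f : Lp H p μ) : ℝ :=
  sInf {δ : ℝ | ∃ U : Submodule ℝ H, FiniteDimensional ℝ U ∧ Module.finrank ℝ U ≤ k ∧
    ∃ g : Lp U p μ, δ = ‖f - U.subtypeL.compLp g‖}

theorem avgWidth_eq_sInf_finrank_eq {Ω : Type*} [MeasurableSpace Ω] {μ : Measure Ω}
    {H : Type*} [NormedAddCommGroup H] [InnerProductSpace ℝ H] {p : ℝ≥0∞}
    (k : ℕ) (hk : (k : Cardinal) ≤ Module.rank ℝ H) (f : Lp H p μ) :
    avgWidth k f = sInf {δ : ℝ | ∃ U : Submodule ℝ H, FiniteDimensional ℝ U ∧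
      Module.finrank ℝ U = k ∧ ∃ g : Lp U p μ, δ = ‖f - U.subtypeL.compLp g‖} := by
  unfold avgWidth
  congr 1
  ext δ
  constructor
  · rintro ⟨U, hU, hUk, g, rfl⟩
    obtain ⟨W, hUW, hW, hWk⟩ : ∃ W : Submodule ℝ H, U ≤ W ∧ FiniteDimensional ℝ W ∧
        Module.finrank ℝ W = k := by
      induction k, hUk using Nat.le_induction with
      | base => exact ⟨U, le_rfl, hU, rfl⟩
      | succ n hn ih =>
        obtain ⟨W, hUW, hW, hWn⟩ := ih (le_trans (by exact_mod_cast n.le_succ) hk)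
        have hne : W ≠ ⊤ := by
          rintro rfl
          have h1 : Module.rank ℝ H = n := by
            rw [← rank_top (R := ℝ) (M := H), ← Module.finrank_eq_rank, hWn]
          rw [h1] at hk
          have : n + 1 ≤ n := by exact_mod_cast hk
          omega
        obtain ⟨x, -, hx⟩ := SetLike.exists_of_lt (lt_top_iff_ne_top.mpr hne)
        refine ⟨W ⊔ Submodule.span ℝ {x}, hUW.trans le_sup_left, inferInstance, ?_⟩
        have hx0 : x ≠ 0 := fun h => hx (h ▸ W.zero_mem)
        have hinf : W ⊓ Submodule.span ℝ {x} = ⊥ :=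
          disjoint_iff.mp ((Submodule.disjoint_span_singleton' hx0).mpr hx)
        have := Submodule.finrank_sup_add_finrank_inf_eq W (Submodule.span ℝ {x})
        rw [hinf, finrank_bot, finrank_span_singleton hx0, hWn] at this
        simpa using this
    refine ⟨W, hW, hWk, (⟨Submodule.inclusion hUW, by
      exact continuous_subtype_val.subtype_mk _⟩ : U →L[ℝ] W).compLp g, ?_⟩
    congr 2
    apply Lp.ext
    filter_upwards [U.subtypeL.coeFn_compLp g,
      W.subtypeL.coeFn_compLp ((⟨Submodule.inclusion hUW, by
        exact continuous_subtype_val.subtype_mk _⟩ : U →L[ℝ] W).compLp g),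
      (⟨Submodule.inclusion hUW, by
        exact continuous_subtype_val.subtype_mk _⟩ : U →L[ℝ] W).coeFn_compLp g] with x h1 h2 h3
    rw [h1, h2, h3]
    rfl
  · rintro ⟨U, hU, hUk, g, rfl⟩
    exact ⟨U, hU, hUk.le, g, rfl⟩

/-- The class in `L²(Ω; H)` of the function `y ↦ v(y) u`, for `u ∈ H` and `v ∈ L²(Ω)`. -/
def elemTensor {Ω : Type*} [MeasurableSpace Ω] {μ : Measure Ω}
    {H : Type*} [NormedAddCommGroup H] [InnerProductSpace ℝ H]
    (u : H) (v : Lp ℝ 2 μ) : Lp H 2 μ :=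
  (ContinuousLinearMap.toSpanSingleton ℝ u).compLp v

/-- A Schmidt decomposition `f = ∑ σ_i u_i v_i` of rank `r`, possibly infinite, converging in
`L²(Ω; H)`. Indices start at `0`, so `σ i` is the `(i+1)`-st singular value. The sequence `σ` is
continued by `0` beyond the rank; the values of `u` and `v` there are irrelevant. -/
structure IsSchmidtDecomposition {Ω : Type*} [MeasurableSpace Ω] {μ : Measure Ω}
    {H : Type*} [NormedAddCommGroup H] [InnerProductSpace ℝ H]
    (f : Lp H 2 μ) (r : ℕ∞) (σ : ℕ → ℝ) (u : ℕ → H) (v : ℕ → Lp ℝ 2 μ) : Prop where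
  antitone : Antitone σ
  pos : ∀ i : ℕ, (i : ℕ∞) < r → 0 < σ i
  eq_zero : ∀ i : ℕ, r ≤ (i : ℕ∞) → σ i = 0
  orthonormal_left : Orthonormal ℝ (fun i : {i : ℕ // (i : ℕ∞) < r} => u i)
  orthonormal_right : Orthonormal ℝ (fun i : {i : ℕ // (i : ℕ∞) < r} => v i)
  hasSum : HasSum (fun i : ℕ => σ i • elemTensor (u i) (v i)) f

/-- `σ` is the nonincreasing sequence of singular values of `f`, continued by `0`. -/
def IsSingularValueSequence {Ω : Type*} [MeasurableSpace Ω] {μ : Measure Ω}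
    {H : Type*} [NormedAddCommGroup H] [InnerProductSpace ℝ H]
    (f : Lp H 2 μ) (σ : ℕ → ℝ) : Prop :=
  ∃ (r : ℕ∞) (u : ℕ → H) (v : ℕ → Lp ℝ 2 μ), IsSchmidtDecomposition f r σ u v

/-- The span of the samples `g(y_1), …, g(y_k)`. -/
def sampleSpan {Ω : Type*} {H : Type*} [NormedAddCommGroup H] [InnerProductSpace ℝ H] {k : ℕ}
    (g : Ω → H) (y : Fin k → Ω) : Submodule ℝ H :=
  Submodule.span ℝ (Set.range fun i => g (y i))

instance sampleSpan.finiteDimensional {Ω : Type*} {H : Type*} [NormedAddCommGroup H]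
    [InnerProductSpace ℝ H] {k : ℕ} (g : Ω → H) (y : Fin k → Ω) :
    FiniteDimensional ℝ (sampleSpan g y) :=
  FiniteDimensional.span_of_finite ℝ (Set.finite_range _)

/-- The error `‖f - Π_y f‖` in `L²(Ω; H)`, where `Π_y` is the orthogonal projection of `H` onto the
span of the samples `g(y_1), …, g(y_k)`; here `g` is the representative of `f` that is sampled. -/
def sampleError {Ω : Type*} [MeasurableSpace Ω] {μ : Measure Ω}
    {H : Type*} [NormedAddCommGroup H] [InnerProductSpace ℝ H] {k : ℕ}
    (f : Lp H 2 μ) (g : Ω → H) (y : Fin k → Ω) : ℝ :=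
  ‖f - (sampleSpan g y).starProjection.compLp f‖

end

/-! The method is volume sampling. Let `D n` be the integral over `n` independent samples of the
Gram determinant of `f(y_1), …, f(y_n)`. A Gram determinant is that of the base times the squared
height (`det_gram_succAbove`), so integrating out one of `k+1` samples gives `D (k+1) = ∫ Gram(y) ‖f
- Π_y f‖²` over `k` samples. If `D (k+1) ≤ (k+1) d_k² D k` and `D k ≠ 0`, then averaging against the
weight `Gram(y)` yields a set of positive measure where the bound holds (`exists_good_set_of_pos`).

For this inequality (`gramLintegral_succ_le`), split `f = p + q`, with `p` the first `k` Schmidt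
terms. The functions `v_i` occurring in `p` and `q` are orthogonal, so `A p ⊥ B q` for all operators
`A`, `B` on `H`. Hence replacing `f` by `p` in one slot costs at most `D k ‖q‖²`. After `k+1`
replacements the determinant vanishes, as `p` takes values in dimension at most `k`.

If `D k = 0`, let `n < k` be the last index with `D n ≠ 0`: suitable `n` samples already reproduce
`f`, and the remaining ones are arbitrary (`exists_exact_set`).

The Schmidt decomposition comes from greedy deflation of the compact operator `h ↦ ⟨h, f(·)⟩`; the
width formula is the Eckart–Young argument. -/

noncomputable section

open scoped InnerProductSpace
open Filter Topology

variable {Ω : Type*} [MeasurableSpace Ω] {μ : Measure Ω}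
  {H : Type*} [NormedAddCommGroup H] [InnerProductSpace ℝ H]

/-! ### Elementary tensors, the contraction operator and its leading singular vector -/

namespace elemTensor

/-- `elemTensor` as a continuous bilinear map. -/
def bilin (μ : Measure Ω) (H : Type*) [NormedAddCommGroup H] [InnerProductSpace ℝ H] :
    H →L[ℝ] Lp ℝ 2 μ →L[ℝ] Lp H 2 μ :=
  ContinuousLinearMap.compLpL₂ 2 μ (ContinuousLinearMap.lsmul ℝ ℝ).flip

theorem eq_bilin (u : H) (v : Lp ℝ 2 μ) : elemTensor u v = bilin μ H u v := by
  rw [elemTensor, bilin, ContinuousLinearMap.compLpL₂_apply_apply]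
  congr 1

theorem coeFn (u : H) (v : Lp ℝ 2 μ) : elemTensor u v =ᵐ[μ] fun x => v x • u := by
  filter_upwards [(ContinuousLinearMap.toSpanSingleton ℝ u).coeFn_compLp v] with x hx
  simpa [elemTensor] using hx

end elemTensor

/-- The contraction `f ↦ (h ↦ ⟨h, f(·)⟩)` as a continuous linear map. -/
def contractionL (μ : Measure Ω) (H : Type*) [NormedAddCommGroup H] [InnerProductSpace ℝ H] :
    Lp H 2 μ →L[ℝ] H →L[ℝ] Lp ℝ 2 μ :=
  (ContinuousLinearMap.compLpL₂ 2 μ (innerSL ℝ)).flip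

/-- The contraction `h ↦ ⟨h, f(·)⟩` of a class `f` in `L²(Ω; H)`. -/
def contraction (f : Lp H 2 μ) : H →L[ℝ] Lp ℝ 2 μ :=
  contractionL μ H f

theorem contraction_apply (f : Lp H 2 μ) (h : H) :
    contraction f h = (innerSL ℝ h).compLp f := rfl

theorem contraction_sub (f g : Lp H 2 μ) : contraction (f - g) = contraction f - contraction g :=
  map_sub _ _ _

theorem contraction_zero : contraction (0 : Lp H 2 μ) = 0 :=
  map_zero _

theorem continuous_contraction :
    Continuous (contraction : Lp H 2 μ → H →L[ℝ] Lp ℝ 2 μ) :=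
  (contractionL μ H).cont

theorem inner_elemTensor_left (u : H) (v : Lp ℝ 2 μ) (f : Lp H 2 μ) :
    ⟪elemTensor u v, f⟫_ℝ = ⟪v, contraction f u⟫_ℝ := by
  rw [L2.inner_def, L2.inner_def]
  apply integral_congr_ae
  filter_upwards [elemTensor.coeFn u v, (innerSL ℝ u).coeFn_compLp f] with x h1 h2
  rw [h1, contraction_apply, h2]
  simp [inner_smul_left, mul_comm]

theorem compLp_elemTensor {H' : Type*} [NormedAddCommGroup H'] [InnerProductSpace ℝ H']
    (A : H →L[ℝ] H') (u : H) (v : Lp ℝ 2 μ) :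
    A.compLp (elemTensor u v) = elemTensor (A u) v := by
  apply Lp.ext
  filter_upwards [elemTensor.coeFn u v, elemTensor.coeFn (A u) v,
    A.coeFn_compLp (elemTensor u v)] with x h1 h2 h3
  rw [h3, h1, h2, map_smul]

theorem contraction_elemTensor (u : H) (v : Lp ℝ 2 μ) (h : H) :
    contraction (elemTensor u v) h = ⟪h, u⟫_ℝ • v := by
  rw [contraction_apply, compLp_elemTensor]
  apply Lp.ext
  filter_upwards [elemTensor.coeFn (innerSL ℝ h u) v, Lp.coeFn_smul (⟪h, u⟫_ℝ) v] with x h1 h2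
  rw [h1, h2]
  simp [mul_comm]

theorem inner_elemTensor_elemTensor (u u' : H) (v v' : Lp ℝ 2 μ) :
    ⟪elemTensor u v, elemTensor u' v'⟫_ℝ = ⟪u, u'⟫_ℝ * ⟪v, v'⟫_ℝ := by
  rw [inner_elemTensor_left, contraction_elemTensor, inner_smul_right]

theorem norm_elemTensor (u : H) (v : Lp ℝ 2 μ) : ‖elemTensor u v‖ = ‖u‖ * ‖v‖ := by
  have h := inner_elemTensor_elemTensor u u v v
  rw [real_inner_self_eq_norm_sq, real_inner_self_eq_norm_sq, real_inner_self_eq_norm_sq,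
    ← mul_pow] at h
  exact (pow_left_inj₀ (norm_nonneg _) (by positivity) two_ne_zero).mp h

/-- Vanishing contraction means orthogonality to all elementary tensors. These include the constants
times indicators, whose span is dense. -/
theorem eq_zero_of_contraction_eq_zero {f : Lp H 2 μ} (hf : contraction f = 0) : f = 0 := by
  have key : ∀ g : Lp H 2 μ, ⟪g, f⟫_ℝ = 0 := by
    intro g
    induction g using Lp.induction (by simp : (2 : ℝ≥0∞) ≠ ∞) with
    | indicatorConst c hs hμs =>
      rw [Lp.simpleFunc.coe_indicatorConst, indicatorConstLp_eq_toSpanSingleton_compLp]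
      change ⟪elemTensor c _, f⟫_ℝ = 0
      rw [inner_elemTensor_left, hf]
      simp
    | add _ _ _ h1 h2 => rw [inner_add_left, h1, h2, add_zero]
    | isClosed => exact isClosed_eq (by fun_prop) continuous_const
  exact inner_self_eq_zero.mp (key f)

/-- Simple functions give finite-rank operators, `contraction` is continuous into the operator norm,
and compactness survives norm limits. -/
theorem isCompactOperator_contraction (f : Lp H 2 μ) : IsCompactOperator (contraction f) := by
  induction f using Lp.induction (by simp : (2 : ℝ≥0∞) ≠ ∞) with
  | indicatorConst c hs hμs =>
    rw [Lp.simpleFunc.coe_indicatorConst, indicatorConstLp_eq_toSpanSingleton_compLp]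
    set w : Lp ℝ 2 μ := indicatorConstLp 2 hs hμs.ne (1 : ℝ)
    have h1 : contraction (elemTensor c w) =
        (ContinuousLinearMap.toSpanSingleton ℝ w).comp (innerSL ℝ c) := by
      ext1 h
      rw [contraction_elemTensor]
      simp [real_inner_comm]
    change IsCompactOperator (contraction (elemTensor c w))
    rw [h1]
    have h2 : IsCompactOperator (ContinuousLinearMap.toSpanSingleton ℝ w) :=
      isCompactOperator_of_locallyCompactSpace_rng (ContinuousLinearMap.toSpanSingleton ℝ w)
    exact h2.comp_clm _
  | @add f g hf hg hd h1 h2 =>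
    have : contraction (hf.toLp f + hg.toLp g) =
      contraction (hf.toLp f) + contraction (hg.toLp g) := map_add _ _ _
    rw [this]
    exact h1.add h2
  | isClosed =>
    exact isClosed_setOfPred_isCompactOperator.preimage continuous_contraction

-- The norm of the compact self-adjoint operator `K* K` is its spectral radius, attained at a
-- nonzero spectral value, which is therefore an eigenvalue. A unit eigenvector is the required `u`.
open Module.End in
theorem IsCompactOperator.exists_norm_eq_opNorm {E F : Type*} [NormedAddCommGroup E]
    [InnerProductSpace ℝ E] [CompleteSpace E] [NormedAddCommGroup F] [InnerProductSpace ℝ F]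
    [CompleteSpace F] {K : E →L[ℝ] F} (hK : IsCompactOperator K) (h0 : K ≠ 0) :
    ∃ u : E, ‖u‖ = 1 ∧ ‖K u‖ = ‖K‖ ∧ ∀ h, ⟪K u, K h⟫_ℝ = ‖K u‖ ^ 2 * ⟪u, h⟫_ℝ := by
  set T : E →L[ℝ] E := K.adjoint.comp K with hTdef
  have hTc : IsCompactOperator T := hK.clm_comp K.adjoint
  have hTs : IsSelfAdjoint T := by
    rw [ContinuousLinearMap.isSelfAdjoint_iff', hTdef, ContinuousLinearMap.adjoint_comp,
      ContinuousLinearMap.adjoint_adjoint]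
  have hTn : ‖T‖ = ‖K‖ * ‖K‖ := ContinuousLinearMap.norm_adjoint_comp_self K
  have hT0 : 0 < ‖T‖ := by rw [hTn]; have := norm_pos_iff.mpr h0; positivity
  have hin : ∀ x y, ⟪T x, y⟫_ℝ = ⟪K x, K y⟫_ℝ := fun x y => by
    simp [hTdef, ContinuousLinearMap.adjoint_inner_left]
  -- Over `ℝ` nonemptiness is not automatic; here an empty spectrum would force the spectral radius,
  -- hence `‖T‖`, to be zero.
  have hne : (spectrum ℝ T).Nonempty := by
    by_contra hcon
    rw [Set.not_nonempty_iff_eq_empty] at hcon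
    have := T.spectralRadius_eq_nnnorm hTs
    rw [spectralRadius, hcon] at this
    simp at this
    exact hT0.ne' (by simpa using this.symm)
  obtain ⟨l, hl, hl'⟩ := spectrum.exists_nnnorm_eq_spectralRadius_of_nonempty hne
  rw [T.spectralRadius_eq_nnnorm hTs] at hl'
  have hln : ‖l‖ = ‖T‖ := by exact_mod_cast congrArg ENNReal.toReal hl'
  have hl0 : l ≠ 0 := by rintro rfl; simp at hln; exact hT0.ne hln
  have hev := (hTc.hasEigenvalue_iff_mem_spectrum hl0).mpr hl
  have hlnn : 0 ≤ l := eigenvalue_nonneg_of_nonneg hev fun x => by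
    change 0 ≤ ⟪x, T x⟫_ℝ
    rw [real_inner_comm, hin]
    exact real_inner_self_nonneg
  rw [Real.norm_of_nonneg hlnn] at hln
  obtain ⟨w, hw⟩ := hev.exists_hasEigenvector
  have hw0 : ‖w‖ ≠ 0 := norm_ne_zero_iff.mpr hw.2
  set u : E := ‖w‖⁻¹ • w
  have hu1 : ‖u‖ = 1 := by simp [u, norm_smul, hw0]
  have hTu : T u = l • u := by
    have : T w = l • w := hw.apply_eq_smul
    simp [u, this, smul_comm l]
  have hKu : ∀ h, ⟪K u, K h⟫_ℝ = l * ⟪u, h⟫_ℝ := fun h => by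
    rw [← hin, hTu, inner_smul_left]; simp
  have hKu2 : ‖K u‖ ^ 2 = l := by
    rw [← real_inner_self_eq_norm_sq, hKu, real_inner_self_eq_norm_sq, hu1]; simp
  refine ⟨u, hu1, ?_, fun h => by rw [hKu2, hKu]⟩
  rw [← pow_left_inj₀ (norm_nonneg _) (norm_nonneg _) two_ne_zero, hKu2, hln, hTn, sq]

/-- The default `u = 0` for `f = 0` makes the greedy recursion stationary once the remainder
vanishes, so finite and infinite rank are handled together. -/
theorem exists_leading_vector [CompleteSpace H] (f : Lp H 2 μ) :
    ∃ u : H, (f ≠ 0 → ‖u‖ = 1) ∧ (f = 0 → u = 0) ∧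
      (∀ h, ‖contraction f h‖ ≤ ‖contraction f u‖ * ‖h‖) ∧
      (f ≠ 0 → contraction f u ≠ 0) ∧
      ∀ h, ⟪contraction f u, contraction f h⟫_ℝ = ‖contraction f u‖ ^ 2 * ⟪u, h⟫_ℝ := by
  by_cases hf : f = 0
  · subst hf
    exact ⟨0, by simp [contraction_zero]⟩
  · have h0 : contraction f ≠ 0 := fun h => hf (eq_zero_of_contraction_eq_zero h)
    obtain ⟨u, h1, h2, h3⟩ := (isCompactOperator_contraction f).exists_norm_eq_opNorm h0
    refine ⟨u, fun _ => h1, fun h => absurd h hf, fun h => ?_, fun _ h => h0 ?_, h3⟩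
    · rw [h2]
      exact (contraction f).le_opNorm h
    · rw [← norm_eq_zero, ← h2, h, norm_zero]

/-! ### Existence of a Schmidt decomposition by greedy deflation -/

/-- A left singular vector of `f` for its largest singular value. -/
def leadingVector [CompleteSpace H] (f : Lp H 2 μ) : H :=
  (exists_leading_vector f).choose

/-- The remainders of the greedy approximation of `f` by elementary tensors. -/
def greedyRemainder [CompleteSpace H] (f : Lp H 2 μ) : ℕ → Lp H 2 μ
  | 0 => f
  | n + 1 => greedyRemainder f n - elemTensor (leadingVector (greedyRemainder f n))
      (contraction (greedyRemainder f n) (leadingVector (greedyRemainder f n)))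

/-- The left vectors of the greedy approximation. -/
def greedyLeft [CompleteSpace H] (f : Lp H 2 μ) (n : ℕ) : H :=
  leadingVector (greedyRemainder f n)

/-- The right vectors of the greedy approximation, not normalized. -/
def greedyRight [CompleteSpace H] (f : Lp H 2 μ) (n : ℕ) : Lp ℝ 2 μ :=
  contraction (greedyRemainder f n) (greedyLeft f n)

section Greedy

variable [CompleteSpace H] (f : Lp H 2 μ)

theorem greedyRemainder_succ (n : ℕ) :
    greedyRemainder f (n + 1) =
      greedyRemainder f n - elemTensor (greedyLeft f n) (greedyRight f n) := rfl

theorem norm_greedyLeft {n : ℕ} (h : greedyRemainder f n ≠ 0) : ‖greedyLeft f n‖ = 1 :=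
  (exists_leading_vector (greedyRemainder f n)).choose_spec.1 h

theorem greedyLeft_eq_zero {n : ℕ} (h : greedyRemainder f n = 0) : greedyLeft f n = 0 :=
  (exists_leading_vector (greedyRemainder f n)).choose_spec.2.1 h

theorem norm_contraction_greedyRemainder_le (n : ℕ) (h : H) :
    ‖contraction (greedyRemainder f n) h‖ ≤ ‖greedyRight f n‖ * ‖h‖ :=
  (exists_leading_vector (greedyRemainder f n)).choose_spec.2.2.1 h

theorem greedyRight_ne_zero {n : ℕ} (h : greedyRemainder f n ≠ 0) : greedyRight f n ≠ 0 :=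
  (exists_leading_vector (greedyRemainder f n)).choose_spec.2.2.2.1 h

theorem inner_greedyRight_contraction (n : ℕ) (h : H) :
    ⟪greedyRight f n, contraction (greedyRemainder f n) h⟫_ℝ =
      ‖greedyRight f n‖ ^ 2 * ⟪greedyLeft f n, h⟫_ℝ :=
  (exists_leading_vector (greedyRemainder f n)).choose_spec.2.2.2.2 h

theorem greedyRight_eq_zero {n : ℕ} (h : greedyRemainder f n = 0) : greedyRight f n = 0 := by
  rw [greedyRight, greedyLeft_eq_zero f h, map_zero]

theorem greedyRemainder_eq_zero_of_le {m n : ℕ} (hmn : m ≤ n) (h : greedyRemainder f m = 0) :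
    greedyRemainder f n = 0 := by
  induction n, hmn using Nat.le_induction with
  | base => exact h
  | succ n _ ih =>
    rw [greedyRemainder_succ, ih, greedyLeft_eq_zero f ih, elemTensor.eq_bilin]
    simp

theorem contraction_greedyRemainder_succ (n : ℕ) (h : H) :
    contraction (greedyRemainder f (n + 1)) h =
      contraction (greedyRemainder f n) h - ⟪h, greedyLeft f n⟫_ℝ • greedyRight f n := by
  rw [greedyRemainder_succ, contraction_sub, _root_.sub_apply, contraction_elemTensor]

/-- By the singular vector equation, a left vector for a nonzero singular value is orthogonal to the
kernel of the operator. -/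
theorem inner_greedyLeft_eq_zero_of_contraction {m n : ℕ}
    (h : contraction (greedyRemainder f n) (greedyLeft f m) = 0) :
    ⟪greedyLeft f n, greedyLeft f m⟫_ℝ = 0 := by
  by_cases h0 : greedyRemainder f n = 0
  · rw [greedyLeft_eq_zero f h0, inner_zero_left]
  · have h1 := inner_greedyRight_contraction f n (greedyLeft f m)
    rw [h, inner_zero_right] at h1
    have h2 : ‖greedyRight f n‖ ^ 2 ≠ 0 := by
      have := greedyRight_ne_zero f h0
      positivity
    exact (mul_eq_zero.mp h1.symm).resolve_left h2

/-- Step `m` puts its own left vector into the kernel. It stays there, since each later step changes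
the operator only along a left vector orthogonal to that kernel. -/
theorem contraction_greedyRemainder_greedyLeft {m n : ℕ} (hmn : m < n) :
    contraction (greedyRemainder f n) (greedyLeft f m) = 0 := by
  induction n, hmn using Nat.le_induction with
  | base =>
    rw [contraction_greedyRemainder_succ]
    by_cases h0 : greedyRemainder f m = 0
    · rw [greedyLeft_eq_zero f h0]
      simp
    · rw [real_inner_self_eq_norm_sq, norm_greedyLeft f h0]
      simp [greedyRight]
  | succ n hn ih =>
    rw [contraction_greedyRemainder_succ, ih, real_inner_comm,
      inner_greedyLeft_eq_zero_of_contraction f ih]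
    simp

theorem inner_greedyLeft {m n : ℕ} (hmn : m < n) : ⟪greedyLeft f n, greedyLeft f m⟫_ℝ = 0 :=
  inner_greedyLeft_eq_zero_of_contraction f (contraction_greedyRemainder_greedyLeft f hmn)

/-- Deflations along earlier left vectors do not change the operator on a vector orthogonal to them.
-/
theorem greedyRight_eq_contraction {m n : ℕ} (hmn : m ≤ n) :
    greedyRight f n = contraction (greedyRemainder f m) (greedyLeft f n) := by
  have key : ∀ l, m ≤ l → l ≤ n → contraction (greedyRemainder f l) (greedyLeft f n) =
      contraction (greedyRemainder f m) (greedyLeft f n) := by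
    intro l hl
    induction l, hl using Nat.le_induction with
    | base => exact fun _ => rfl
    | succ l _ ih =>
      intro hln
      rw [contraction_greedyRemainder_succ, inner_greedyLeft f (by omega), ih (by omega)]
      simp
  exact key n hmn le_rfl

theorem inner_greedyRight {m n : ℕ} (hmn : m < n) : ⟪greedyRight f m, greedyRight f n⟫_ℝ = 0 := by
  rw [greedyRight_eq_contraction f hmn.le, inner_greedyRight_contraction, real_inner_comm,
    inner_greedyLeft f hmn, mul_zero]

theorem inner_greedyLeft_of_ne {m n : ℕ} (h : m ≠ n) :
    ⟪greedyLeft f m, greedyLeft f n⟫_ℝ = 0 := by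
  rcases lt_or_gt_of_ne h with h | h
  · rw [real_inner_comm]; exact inner_greedyLeft f h
  · exact inner_greedyLeft f h

theorem inner_greedyRight_of_ne {m n : ℕ} (h : m ≠ n) :
    ⟪greedyRight f m, greedyRight f n⟫_ℝ = 0 := by
  rcases lt_or_gt_of_ne h with h | h
  · exact inner_greedyRight f h
  · rw [real_inner_comm]; exact inner_greedyRight f h

theorem norm_greedyLeft_le_one (n : ℕ) : ‖greedyLeft f n‖ ≤ 1 := by
  by_cases h : greedyRemainder f n = 0
  · simp [greedyLeft_eq_zero f h]
  · exact (norm_greedyLeft f h).le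

theorem antitone_norm_greedyRight : Antitone fun n => ‖greedyRight f n‖ := by
  refine antitone_nat_of_succ_le fun n => ?_
  rw [greedyRight_eq_contraction f n.le_succ]
  refine (norm_contraction_greedyRemainder_le f n _).trans ?_
  exact mul_le_of_le_one_right (norm_nonneg _) (norm_greedyLeft_le_one f _)

theorem norm_elemTensor_greedy (n : ℕ) :
    ‖elemTensor (greedyLeft f n) (greedyRight f n)‖ = ‖greedyRight f n‖ := by
  rw [norm_elemTensor]
  by_cases h : greedyRemainder f n = 0
  · simp [greedyRight_eq_zero f h]
  · rw [norm_greedyLeft f h, one_mul]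

theorem norm_greedyRemainder_sq (n : ℕ) :
    ‖greedyRemainder f (n + 1)‖ ^ 2 = ‖greedyRemainder f n‖ ^ 2 - ‖greedyRight f n‖ ^ 2 := by
  rw [greedyRemainder_succ, norm_sub_sq_real, norm_elemTensor_greedy, real_inner_comm,
    inner_elemTensor_left]
  change _ - 2 * ⟪greedyRight f n, greedyRight f n⟫_ℝ + _ = _
  rw [real_inner_self_eq_norm_sq]
  ring

theorem sum_norm_greedyRight_sq (n : ℕ) :
    ∑ i ∈ Finset.range n, ‖greedyRight f i‖ ^ 2 = ‖f‖ ^ 2 - ‖greedyRemainder f n‖ ^ 2 := by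
  induction n with
  | zero => simp [greedyRemainder]
  | succ n ih => rw [Finset.sum_range_succ, ih, norm_greedyRemainder_sq]; ring

theorem greedyRemainder_eq_sub_sum (n : ℕ) : greedyRemainder f n =
    f - ∑ i ∈ Finset.range n, elemTensor (greedyLeft f i) (greedyRight f i) := by
  induction n with
  | zero => simp [greedyRemainder]
  | succ n ih => rw [Finset.sum_range_succ, greedyRemainder_succ, ih]; abel

theorem summable_norm_greedyRight_sq : Summable fun n => ‖greedyRight f n‖ ^ 2 := by
  refine summable_of_sum_range_le (c := ‖f‖ ^ 2) (fun n => by positivity) fun n => ?_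
  rw [sum_norm_greedyRight_sq]
  have := sq_nonneg ‖greedyRemainder f n‖
  linarith

theorem summable_of_pairwise_orthogonal {E : Type*} [NormedAddCommGroup E]
    [InnerProductSpace ℝ E] [CompleteSpace E] {x : ℕ → E}
    (ho : Pairwise fun i j => ⟪x i, x j⟫_ℝ = 0) (hs : Summable fun i => ‖x i‖ ^ 2) :
    Summable x := by
  have h1 : ∀ s : Finset ℕ, ‖∑ i ∈ s, x i‖ ^ 2 = ∑ i ∈ s, ‖x i‖ ^ 2 := by
    intro s
    rw [← real_inner_self_eq_norm_sq, sum_inner]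
    refine Finset.sum_congr rfl fun i hi => ?_
    rw [inner_sum, Finset.sum_eq_single_of_mem i hi fun j _ hj => ho hj.symm,
      real_inner_self_eq_norm_sq]
  rw [summable_iff_vanishing_norm] at hs ⊢
  intro ε hε
  obtain ⟨s, hsε⟩ := hs (ε ^ 2) (by positivity)
  refine ⟨s, fun t ht => ?_⟩
  have h2 := hsε t ht
  rw [← h1, Real.norm_of_nonneg (by positivity)] at h2
  exact lt_of_pow_lt_pow_left₀ 2 hε.le h2

/-- Orthogonality and square summability give convergence to some `g`. The remainders have operator
norms bounded by `‖greedyRight f n‖ → 0`, so `f - g` has zero contraction and vanishes. -/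
theorem hasSum_greedy :
    HasSum (fun n => elemTensor (greedyLeft f n) (greedyRight f n)) f := by
  have hsum : Summable fun n => elemTensor (greedyLeft f n) (greedyRight f n) := by
    apply summable_of_pairwise_orthogonal
    · intro i j hij
      rw [inner_elemTensor_elemTensor, inner_greedyLeft_of_ne f hij, zero_mul]
    · simpa [norm_elemTensor_greedy] using summable_norm_greedyRight_sq f
  obtain ⟨g, hg⟩ := hsum
  have h1 : Tendsto (greedyRemainder f) atTop (𝓝 (f - g)) := by
    simp_rw [funext (greedyRemainder_eq_sub_sum f)]
    exact tendsto_const_nhds.sub hg.tendsto_sum_nat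
  have h2 : contraction (f - g) = 0 := by
    ext1 h
    have h3 : Tendsto (fun n => contraction (greedyRemainder f n) h) atTop
        (𝓝 (contraction (f - g) h)) :=
      ((ContinuousLinearMap.apply ℝ (Lp ℝ 2 μ) h).continuous.comp
        continuous_contraction).continuousAt.tendsto.comp h1
    have h4 : Tendsto (fun n => ‖greedyRight f n‖ ^ 2) atTop (𝓝 0) :=
      (summable_norm_greedyRight_sq f).tendsto_atTop_zero
    have h5 : Tendsto (fun n => ‖greedyRight f n‖) atTop (𝓝 0) := by
      have := (Real.continuous_sqrt.tendsto 0).comp h4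
      simpa [Function.comp_def] using this
    have h6 : Tendsto (fun n => contraction (greedyRemainder f n) h) atTop (𝓝 0) :=
      squeeze_zero_norm (norm_contraction_greedyRemainder_le f · h)
        (by simpa using h5.mul_const ‖h‖)
    exact tendsto_nhds_unique h3 h6
  have h7 := eq_zero_of_contraction_eq_zero h2
  rwa [← sub_eq_zero.mp h7] at hg

theorem exists_rank : ∃ r : ℕ∞, ∀ n : ℕ, (n : ℕ∞) < r ↔ greedyRemainder f n ≠ 0 := by
  classical
  by_cases h : ∃ n, greedyRemainder f n = 0
  · refine ⟨(Nat.find h : ℕ), fun n => ?_⟩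
    rw [Nat.cast_lt, Nat.lt_find_iff]
    exact ⟨fun h1 => h1 n le_rfl,
      fun h1 m hm h2 => h1 (greedyRemainder_eq_zero_of_le f hm h2)⟩
  · push Not at h
    exact ⟨⊤, fun n => by simp [h n]⟩

theorem exists_isSingularValueSequence : ∃ σ : ℕ → ℝ, IsSingularValueSequence f σ := by
  obtain ⟨r, hr⟩ := exists_rank f
  refine ⟨fun n => ‖greedyRight f n‖, r, greedyLeft f,
    fun n => ‖greedyRight f n‖⁻¹ • greedyRight f n, ?_⟩
  refine ⟨antitone_norm_greedyRight f, fun i hi => ?_, fun i hi => ?_, ⟨?_, ?_⟩, ⟨?_, ?_⟩, ?_⟩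
  · exact norm_pos_iff.mpr (greedyRight_ne_zero f ((hr i).mp hi))
  · have : greedyRemainder f i = 0 := by
      by_contra h
      exact absurd ((hr i).mpr h) (not_lt.mpr hi)
    simp [greedyRight_eq_zero f this]
  · exact fun i => norm_greedyLeft f ((hr i).mp i.2)
  · exact fun i j hij => inner_greedyLeft_of_ne f fun h => hij (Subtype.ext h)
  · intro i
    have := norm_ne_zero_iff.mpr (greedyRight_ne_zero f ((hr i).mp i.2))
    simp [norm_smul, this]
  · intro i j hij
    simp only
    rw [inner_smul_left, inner_smul_right,
      inner_greedyRight_of_ne f fun h => hij (Subtype.ext h)]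
    simp
  · have key : ∀ n, ‖greedyRight f n‖ • elemTensor (greedyLeft f n)
        (‖greedyRight f n‖⁻¹ • greedyRight f n) =
        elemTensor (greedyLeft f n) (greedyRight f n) := by
      intro n
      simp only [elemTensor.eq_bilin]
      by_cases h : greedyRight f n = 0
      · simp [h]
      · have := norm_ne_zero_iff.mpr h
        rw [map_smul, smul_inv_smul₀ this]
    simpa only [key] using hasSum_greedy f

end Greedy

/-! ### The width as an infimum of projection errors -/

theorem compLp_compLp {H₁ H₂ : Type*} [NormedAddCommGroup H₁] [NormedSpace ℝ H₁]
    [NormedAddCommGroup H₂] [NormedSpace ℝ H₂] (B : H₁ →L[ℝ] H₂) (A : H →L[ℝ] H₁)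
    (f : Lp H 2 μ) : B.compLp (A.compLp f) = (B.comp A).compLp f := by
  apply Lp.ext
  filter_upwards [B.coeFn_compLp (A.compLp f), A.coeFn_compLp f,
    (B.comp A).coeFn_compLp f] with x h1 h2 h3
  rw [h1, h2, h3]
  rfl

theorem compLp_sub (A : H →L[ℝ] H) (f g : Lp H 2 μ) :
    A.compLp (f - g) = A.compLp f - A.compLp g :=
  map_sub (A.compLpL 2 μ) f g

theorem sub_starProjection_compLp (U : Submodule ℝ H) [U.HasOrthogonalProjection]
    (f : Lp H 2 μ) : f - U.starProjection.compLp f = Uᗮ.starProjection.compLp f := by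
  apply Lp.ext
  filter_upwards [Lp.coeFn_sub f (U.starProjection.compLp f), U.starProjection.coeFn_compLp f,
    Uᗮ.starProjection.coeFn_compLp f] with x h1 h2 h3
  rw [h1, Pi.sub_apply, h2, h3, Submodule.starProjection_orthogonal_val]

theorem bddBelow_width_set (k : ℕ) (f : Lp H 2 μ) :
    BddBelow {δ : ℝ | ∃ U : Submodule ℝ H, FiniteDimensional ℝ U ∧ Module.finrank ℝ U ≤ k ∧
      ∃ g : Lp U 2 μ, δ = ‖f - U.subtypeL.compLp g‖} :=
  ⟨0, by rintro _ ⟨U, _, _, g, rfl⟩; exact norm_nonneg _⟩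

theorem avgWidth_le_norm_orthogonal {k : ℕ} (f : Lp H 2 μ) (U : Submodule ℝ H)
    [FiniteDimensional ℝ U] (hU : Module.finrank ℝ U ≤ k) :
    avgWidth k f ≤ ‖Uᗮ.starProjection.compLp f‖ := by
  refine csInf_le (bddBelow_width_set k f)
    ⟨U, inferInstance, hU, U.orthogonalProjectionOnto.compLp f, ?_⟩
  rw [compLp_compLp, ← sub_starProjection_compLp]
  rfl

theorem norm_orthogonal_le (f : Lp H 2 μ) (U : Submodule ℝ H) [FiniteDimensional ℝ U]
    (g : Lp U 2 μ) : ‖Uᗮ.starProjection.compLp f‖ ≤ ‖f - U.subtypeL.compLp g‖ := by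
  have h0 : Uᗮ.starProjection.comp U.subtypeL = 0 := by
    ext1 x
    have : Uᗮ.starProjection (x : H) = 0 := by
      rw [Submodule.starProjection_orthogonal_val,
        Submodule.starProjection_eq_self_iff.mpr x.2, sub_self]
    simp [this]
  have h1 : Uᗮ.starProjection.compLp (U.subtypeL.compLp g) = 0 := by
    apply Lp.ext
    filter_upwards [Uᗮ.starProjection.coeFn_compLp (U.subtypeL.compLp g),
      U.subtypeL.coeFn_compLp g, Lp.coeFn_zero H 2 μ] with x h2 h3 h4
    rw [h2, h3, h4]
    exact DFunLike.congr_fun h0 (g x)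
  have h2 : Uᗮ.starProjection.compLp f = Uᗮ.starProjection.compLp (f - U.subtypeL.compLp g) := by
    rw [compLp_sub, h1, sub_zero]
  rw [h2]
  refine (ContinuousLinearMap.norm_compLp_le _ _).trans ?_
  exact mul_le_of_le_one_left (norm_nonneg _) (Submodule.starProjection_norm_le _)

theorem le_avgWidth {k : ℕ} {f : Lp H 2 μ} {c : ℝ}
    (h : ∀ U : Submodule ℝ H, ∀ _ : FiniteDimensional ℝ U, Module.finrank ℝ U ≤ k →
      c ≤ ‖Uᗮ.starProjection.compLp f‖) : c ≤ avgWidth k f := by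
  refine le_csInf ⟨_, ⊥, inferInstance, by simp, 0, rfl⟩ ?_
  rintro _ ⟨U, hU, hUk, g, rfl⟩
  exact (h U hU hUk).trans (norm_orthogonal_le f U g)

theorem avgWidth_nonneg (k : ℕ) (f : Lp H 2 μ) : 0 ≤ avgWidth k f :=
  le_avgWidth fun _ _ _ => norm_nonneg _

/-! ### Eckart–Young: the squared width is the tail of the squared singular values -/

theorem sum_mul_le_sum_range {a c : ℕ → ℝ} {k n : ℕ} (hkn : k ≤ n) (ha : Antitone a)
    (ha0 : ∀ i, 0 ≤ a i) (hc0 : ∀ i, 0 ≤ c i) (hc1 : ∀ i, c i ≤ 1)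
    (hc : ∑ i ∈ Finset.range n, c i ≤ k) :
    ∑ i ∈ Finset.range n, a i * c i ≤ ∑ i ∈ Finset.range k, a i := by
  -- Shifting by the threshold `a k` makes the terms with `i < k` nonnegative and the others
  -- nonpositive, so the best weights are `1` below `k` and `0` from `k` on.
  have h1 : ∑ i ∈ Finset.range n, (a i - a k) * c i ≤
      ∑ i ∈ Finset.range n, if i < k then a i - a k else 0 := by
    refine Finset.sum_le_sum fun i _ => ?_
    split_ifs with h
    · exact mul_le_of_le_one_right (sub_nonneg.mpr (ha h.le)) (hc1 i)
    · exact mul_nonpos_of_nonpos_of_nonneg (sub_nonpos.mpr (ha (not_lt.mp h))) (hc0 i)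
  have h2 : (∑ i ∈ Finset.range n, if i < k then a i - a k else 0) =
      ∑ i ∈ Finset.range k, (a i - a k) := by
    rw [← Finset.sum_filter]
    congr 1
    ext i
    simp only [Finset.mem_filter, Finset.mem_range]
    omega
  rw [h2, Finset.sum_sub_distrib, Finset.sum_const, Finset.card_range, nsmul_eq_mul] at h1
  simp_rw [sub_mul] at h1
  rw [Finset.sum_sub_distrib, ← Finset.mul_sum] at h1
  nlinarith [mul_le_mul_of_nonneg_left hc (ha0 k)]

theorem tsum_tail_le {a c : ℕ → ℝ} {k : ℕ} {b : ℝ} (ha : Antitone a)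
    (ha0 : ∀ i, 0 ≤ a i) (hc0 : ∀ i, 0 ≤ c i) (hc1 : ∀ i, c i ≤ 1)
    (hc : ∀ n, ∑ i ∈ Finset.range n, c i ≤ k) (hs : Summable a)
    (hb : HasSum (fun i => a i * (1 - c i)) b) : ∑' i, a (k + i) ≤ b := by
  have h1 : ∀ n, k ≤ n → ∑ i ∈ Finset.range n, a i - ∑ i ∈ Finset.range k, a i ≤
      ∑ i ∈ Finset.range n, a i * (1 - c i) := by
    intro n hn
    have := sum_mul_le_sum_range hn ha ha0 hc0 hc1 (hc n)
    simp_rw [mul_sub, mul_one]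
    rw [Finset.sum_sub_distrib]
    linarith
  have h2 := le_of_tendsto_of_tendsto
    (hs.hasSum.tendsto_sum_nat.sub_const (∑ i ∈ Finset.range k, a i)) hb.tendsto_sum_nat
    (eventually_atTop.mpr ⟨k, h1⟩)
  rw [← hs.sum_add_tsum_nat_add k] at h2
  simpa [add_comm] using h2

/-- Expand in an orthonormal basis of `U`, exchange the sums, and apply Bessel's inequality to each
basis vector. -/
theorem sum_norm_sq_starProjection_le {ι : Type*} (U : Submodule ℝ H) [FiniteDimensional ℝ U]
    {u : ι → H} (hu : Orthonormal ℝ u) (s : Finset ι) :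
    ∑ i ∈ s, ‖U.starProjection (u i)‖ ^ 2 ≤ Module.finrank ℝ U := by
  let b := stdOrthonormalBasis ℝ U
  have h1 : ∀ i, ‖U.starProjection (u i)‖ ^ 2 = ∑ j, ‖⟪u i, (b j : H)⟫_ℝ‖ ^ 2 := by
    intro i
    have h2 : ‖U.starProjection (u i)‖ = ‖U.orthogonalProjectionOnto (u i)‖ := rfl
    rw [h2, ← b.sum_sq_norm_inner_right]
    refine Finset.sum_congr rfl fun j _ => ?_
    rw [real_inner_comm, Submodule.inner_orthogonalProjectionOnto_eq_of_mem_right]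
  simp_rw [h1]
  rw [Finset.sum_comm]
  calc ∑ j, ∑ i ∈ s, ‖⟪u i, (b j : H)⟫_ℝ‖ ^ 2 ≤ ∑ j, (1 : ℝ) := by
        refine Finset.sum_le_sum fun j _ => ?_
        refine (hu.sum_inner_products_le (b j : H)).trans ?_
        have : ‖(b j : H)‖ = 1 := b.orthonormal.1 j
        rw [this, one_pow]
    _ = Module.finrank ℝ U := by simp

namespace IsSchmidtDecomposition

variable {f : Lp H 2 μ} {r : ℕ∞} {σ : ℕ → ℝ} {u : ℕ → H} {v : ℕ → Lp ℝ 2 μ}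

theorem sigma_nonneg (d : IsSchmidtDecomposition f r σ u v) (i : ℕ) : 0 ≤ σ i := by
  by_cases h : (i : ℕ∞) < r
  · exact (d.pos i h).le
  · exact (d.eq_zero i (not_lt.mp h)).ge

theorem inner_right (d : IsSchmidtDecomposition f r σ u v) (i j : ℕ) :
    σ i * σ j * ⟪v i, v j⟫_ℝ = if i = j then σ i ^ 2 else 0 := by
  by_cases hi : (i : ℕ∞) < r
  · by_cases hj : (j : ℕ∞) < r
    · split_ifs with h
      · subst h
        have : ‖v i‖ = 1 := d.orthonormal_right.1 ⟨i, hi⟩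
        rw [real_inner_self_eq_norm_sq, this]
        ring
      · have : ⟪v i, v j⟫_ℝ = 0 :=
          d.orthonormal_right.2 (i := ⟨i, hi⟩) (j := ⟨j, hj⟩) (by simpa using h)
        rw [this, mul_zero]
    · have := d.eq_zero j (not_lt.mp hj)
      split_ifs with h
      · subst h; simp [this]
      · simp [this]
  · simp [d.eq_zero i (not_lt.mp hi)]

theorem hasSum_compLp (d : IsSchmidtDecomposition f r σ u v) {H' : Type*} [NormedAddCommGroup H']
    [InnerProductSpace ℝ H'] (A : H →L[ℝ] H') :
    HasSum (fun i => σ i • elemTensor (A (u i)) (v i)) (A.compLp f) := by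
  have h := (A.compLpL 2 μ).hasSum d.hasSum
  have h2 : ∀ i, A.compLpL 2 μ (σ i • elemTensor (u i) (v i)) =
      σ i • elemTensor (A (u i)) (v i) := fun i => by
    rw [map_smul, ← compLp_elemTensor]
    rfl
  simp_rw [h2] at h
  exact h

/-- Operators on `H` leave the `v i` untouched, so orthonormality of the latter kills all cross
terms. -/
theorem hasSum_inner_compLp (d : IsSchmidtDecomposition f r σ u v) (A B : H →L[ℝ] H) :
    HasSum (fun i => σ i ^ 2 * ⟪A (u i), B (u i)⟫_ℝ) (⟪A.compLp f, B.compLp f⟫_ℝ) := by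
  have h1 : ∀ i, ⟪B.compLp f, σ i • elemTensor (A (u i)) (v i)⟫_ℝ =
      σ i ^ 2 * ⟪A (u i), B (u i)⟫_ℝ := by
    intro i
    have h2 := (innerSL ℝ (σ i • elemTensor (A (u i)) (v i))).hasSum (d.hasSum_compLp B)
    have h3 : ∀ j, innerSL ℝ (σ i • elemTensor (A (u i)) (v i))
        (σ j • elemTensor (B (u j)) (v j)) =
          if i = j then σ i ^ 2 * ⟪A (u i), B (u i)⟫_ℝ else 0 := by
      intro j
      rw [innerSL_apply_apply, inner_smul_left, inner_smul_right, inner_elemTensor_elemTensor]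
      have := d.inner_right i j
      split_ifs with h
      · subst h
        rw [if_pos rfl] at this
        rw [← this]
        simp
        ring
      · rw [if_neg h] at this
        simp only [conj_trivial]
        linear_combination ⟪A (u i), B (u j)⟫_ℝ * this
    simp_rw [h3] at h2
    rw [real_inner_comm]
    refine HasSum.unique h2 ?_
    simpa using hasSum_single i (f := fun j => if i = j then σ i ^ 2 * ⟪A (u i), B (u i)⟫_ℝ else 0)
      fun j hj => by simp [hj.symm]
  have h4 := (innerSL ℝ (B.compLp f)).hasSum (d.hasSum_compLp A)
  simp only [innerSL_apply_apply, h1] at h4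
  rwa [real_inner_comm]

theorem hasSum_norm_sq_compLp (d : IsSchmidtDecomposition f r σ u v) (A : H →L[ℝ] H) :
    HasSum (fun i => σ i ^ 2 * ‖A (u i)‖ ^ 2) (‖A.compLp f‖ ^ 2) := by
  simpa [real_inner_self_eq_norm_sq] using d.hasSum_inner_compLp A A

theorem antitone_sq (d : IsSchmidtDecomposition f r σ u v) : Antitone fun i => σ i ^ 2 :=
  fun _ j hij => pow_le_pow_left₀ (d.sigma_nonneg j) (d.antitone hij) 2

theorem norm_left (d : IsSchmidtDecomposition f r σ u v) {i : ℕ} (hi : (i : ℕ∞) < r) :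
    ‖u i‖ = 1 := d.orthonormal_left.1 ⟨i, hi⟩

theorem sq_mul_norm_sq (d : IsSchmidtDecomposition f r σ u v) (i : ℕ) :
    σ i ^ 2 * ‖u i‖ ^ 2 = σ i ^ 2 := by
  by_cases hi : (i : ℕ∞) < r
  · rw [d.norm_left hi]; ring
  · rw [d.eq_zero i (not_lt.mp hi)]; ring

theorem summable_sq (d : IsSchmidtDecomposition f r σ u v) : Summable fun i => σ i ^ 2 := by
  simpa [d.sq_mul_norm_sq] using (d.hasSum_norm_sq_compLp (ContinuousLinearMap.id ℝ H)).summable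

theorem tail_le_norm_sq (d : IsSchmidtDecomposition f r σ u v) {k : ℕ} (U : Submodule ℝ H)
    [FiniteDimensional ℝ U] (hU : Module.finrank ℝ U ≤ k) :
    ∑' i, σ (k + i) ^ 2 ≤ ‖Uᗮ.starProjection.compLp f‖ ^ 2 := by
  classical
  -- The share of `u i` captured by `U`. Beyond the rank `u i` is arbitrary, so the weight is set to
  -- `0` to keep it at most `1` and the total at most `k`.
  set c : ℕ → ℝ := fun i => if (i : ℕ∞) < r then ‖U.starProjection (u i)‖ ^ 2 else 0 with hc
  refine tsum_tail_le (a := fun i => σ i ^ 2) (c := c) d.antitone_sq (fun i => sq_nonneg _)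
    (fun i => ?_) (fun i => ?_) (fun n => ?_) d.summable_sq ?_
  · simp only [hc]; split_ifs <;> positivity
  · simp only [hc]
    split_ifs with h
    · refine pow_le_one₀ (norm_nonneg _) ?_
      rw [← d.norm_left h]
      exact Submodule.norm_starProjection_apply_le U (u i)
    · exact zero_le_one
  · have h1 := sum_norm_sq_starProjection_le U d.orthonormal_left
      ((Finset.range n).subtype fun i : ℕ => (i : ℕ∞) < r)
    rw [Finset.sum_subtype_eq_sum_filter (f := fun i => ‖U.starProjection (u i)‖ ^ 2),
      Finset.sum_filter] at h1
    exact h1.trans (by exact_mod_cast hU)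
  · convert d.hasSum_norm_sq_compLp Uᗮ.starProjection using 2 with i
    by_cases h : (i : ℕ∞) < r
    · have h1 := Submodule.norm_sq_eq_add_norm_sq_starProjection (u i) U
      rw [d.norm_left h] at h1
      simp only [hc, if_pos h]
      congr 1
      linarith
    · simp [d.eq_zero i (not_lt.mp h)]

theorem starProjection_orthogonal_left {k i : ℕ} (hi : i < k) (u : ℕ → H) :
    (sampleSpan u (Fin.val : Fin k → ℕ))ᗮ.starProjection (u i) = 0 := by
  rw [Submodule.starProjection_orthogonal_val, sub_eq_zero, eq_comm,
    Submodule.starProjection_eq_self_iff]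
  exact Submodule.subset_span ⟨⟨i, hi⟩, rfl⟩

theorem starProjection_left (d : IsSchmidtDecomposition f r σ u v) {k i : ℕ} (hi : k ≤ i)
    (hir : (i : ℕ∞) < r) : (sampleSpan u (Fin.val : Fin k → ℕ)).starProjection (u i) = 0 := by
  rw [Submodule.starProjection_apply_eq_zero_iff, sampleSpan, Submodule.mem_orthogonal]
  intro w hw
  induction hw using Submodule.span_induction with
  | mem w hw =>
    obtain ⟨j, rfl⟩ := hw
    have hj : (j : ℕ) < i := j.2.trans_le hi
    have hjr : ((j : ℕ) : ℕ∞) < r := lt_trans (by exact_mod_cast hj) hir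
    exact d.orthonormal_left.2 (i := ⟨j, hjr⟩) (j := ⟨i, hir⟩) (by simpa using hj.ne)
  | zero => exact inner_zero_left _
  | add a b _ _ ha hb => rw [inner_add_left, ha, hb, add_zero]
  | smul c a _ ha => rw [inner_smul_left, ha, mul_zero]

theorem norm_orthogonal_sq_le_tail (d : IsSchmidtDecomposition f r σ u v) (k : ℕ) :
    ‖(sampleSpan u (Fin.val : Fin k → ℕ))ᗮ.starProjection.compLp f‖ ^ 2 ≤
      ∑' i, σ (k + i) ^ 2 := by
  have h := d.hasSum_norm_sq_compLp (sampleSpan u (Fin.val : Fin k → ℕ))ᗮ.starProjection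
  rw [← h.tsum_eq, ← h.summable.sum_add_tsum_nat_add k]
  have h0 : ∑ i ∈ Finset.range k, σ i ^ 2 *
      ‖(sampleSpan u (Fin.val : Fin k → ℕ))ᗮ.starProjection (u i)‖ ^ 2 = 0 := by
    refine Finset.sum_eq_zero fun i hi => ?_
    rw [starProjection_orthogonal_left (Finset.mem_range.mp hi)]
    simp
  rw [h0, zero_add]
  simp_rw [add_comm k]
  refine Summable.tsum_le_tsum (fun i => ?_) ((summable_nat_add_iff k).mpr h.summable)
    ((summable_nat_add_iff k).mpr d.summable_sq)
  refine le_trans ?_ (d.sq_mul_norm_sq (i + k)).le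
  gcongr
  exact Submodule.norm_starProjection_apply_le
    (sampleSpan u (Fin.val : Fin k → ℕ))ᗮ (u (i + k))

/-- In every term with `σ i ≠ 0` one of the two projections annihilates `u i`. Plain orthogonality
of the two parts would not suffice later, where they are projected further, depending on the
samples. -/
theorem inner_compLp_starProjection (d : IsSchmidtDecomposition f r σ u v) (k : ℕ)
    (A B : H →L[ℝ] H) :
    ⟪A.compLp ((sampleSpan u (Fin.val : Fin k → ℕ)).starProjection.compLp f),
      B.compLp ((sampleSpan u (Fin.val : Fin k → ℕ))ᗮ.starProjection.compLp f)⟫_ℝ = 0 := by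
  rw [compLp_compLp, compLp_compLp]
  refine (d.hasSum_inner_compLp _ _).unique ?_
  convert hasSum_zero with i
  rw [ContinuousLinearMap.comp_apply, ContinuousLinearMap.comp_apply]
  rcases lt_or_ge i k with hi | hi
  · rw [starProjection_orthogonal_left hi]
    simp
  · by_cases hir : (i : ℕ∞) < r
    · rw [d.starProjection_left hi hir]
      simp
    · simp [d.eq_zero i (not_lt.mp hir)]

end IsSchmidtDecomposition

theorem finrank_sampleSpan_le {α : Type*} {k : ℕ} (g : α → H) (y : Fin k → α) :
    Module.finrank ℝ (sampleSpan g y) ≤ k := by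
  have h := finrank_range_le_card (R := ℝ) fun i => g (y i)
  rw [Fintype.card_fin] at h
  exact h

theorem IsSchmidtDecomposition.avgWidth_sq {f : Lp H 2 μ} {r : ℕ∞} {σ : ℕ → ℝ} {u : ℕ → H}
    {v : ℕ → Lp ℝ 2 μ} (d : IsSchmidtDecomposition f r σ u v) (k : ℕ) :
    avgWidth k f ^ 2 = ∑' i, σ (k + i) ^ 2 := by
  have h0 : 0 ≤ ∑' i, σ (k + i) ^ 2 := tsum_nonneg fun i => sq_nonneg _
  refine le_antisymm ?_ ?_
  · refine le_trans ?_ (d.norm_orthogonal_sq_le_tail k)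
    exact pow_le_pow_left₀ (avgWidth_nonneg k f)
      (avgWidth_le_norm_orthogonal f _ (finrank_sampleSpan_le _ _)) 2
  · rw [← Real.sqrt_le_left (avgWidth_nonneg k f)]
    refine le_avgWidth fun U _ hU => ?_
    exact (Real.sqrt_le_left (norm_nonneg _)).mpr (d.tail_le_norm_sq U hU)

theorem IsSingularValueSequence.hasSum_tail {f : Lp H 2 μ} {σ : ℕ → ℝ}
    (h : IsSingularValueSequence f σ) (k : ℕ) :
    HasSum (fun i => σ (k + i) ^ 2) (avgWidth k f ^ 2) := by
  obtain ⟨r, u, v, d⟩ := h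
  rw [d.avgWidth_sq]
  have := (summable_nat_add_iff k).mpr d.summable_sq
  simp_rw [add_comm _ k] at this
  exact this.hasSum

theorem exists_optimal_subspace [CompleteSpace H] (f : Lp H 2 μ) (k : ℕ) :
    ∃ (U : Submodule ℝ H) (_ : FiniteDimensional ℝ U), Module.finrank ℝ U ≤ k ∧
      ‖Uᗮ.starProjection.compLp f‖ ^ 2 ≤ avgWidth k f ^ 2 ∧
      ∀ A B : H →L[ℝ] H,
        ⟪A.compLp (U.starProjection.compLp f), B.compLp (Uᗮ.starProjection.compLp f)⟫_ℝ = 0 := by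
  obtain ⟨σ, r, u, v, d⟩ := exists_isSingularValueSequence f
  refine ⟨sampleSpan u (Fin.val : Fin k → ℕ), inferInstance, finrank_sampleSpan_le _ _, ?_,
    d.inner_compLp_starProjection k⟩
  rw [d.avgWidth_sq]
  exact d.norm_orthogonal_sq_le_tail k

/-! ### Expected Gram determinants -/

section GramIntegral

theorem gram_sum_smul {n : ℕ} (B : Matrix (Fin n) (Fin n) ℝ) (w : Fin n → H) :
    Matrix.gram ℝ (fun i => ∑ l, B i l • w l) = B * Matrix.gram ℝ w * B.transpose := by
  ext i j
  simp only [Matrix.gram_apply, Matrix.mul_apply, Matrix.transpose_apply, sum_inner, inner_sum,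
    inner_smul_left, inner_smul_right, Finset.sum_mul, Finset.mul_sum, conj_trivial]
  exact Finset.sum_congr rfl fun a _ => Finset.sum_congr rfl fun b _ => by ring

/-- Squared volume is that of the base times squared height: a unimodular row operation replaces `w
j` by its component orthogonal to the other vectors. -/
theorem det_gram_succAbove {n : ℕ} (w : Fin (n + 1) → H) (j : Fin (n + 1)) :
    (Matrix.gram ℝ w).det = (Matrix.gram ℝ fun i => w (j.succAbove i)).det *
      ‖(sampleSpan (fun i => w (j.succAbove i)) id)ᗮ.starProjection (w j)‖ ^ 2 := by
  set V := sampleSpan (fun i => w (j.succAbove i)) id with hV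
  obtain ⟨c, hc⟩ := (Submodule.mem_span_range_iff_exists_fun ℝ).mp
    (V.starProjection_apply_mem (w j))
  -- Coefficients of `w j` minus its projection; the entry `1` at `j` gives `det B = 1`.
  set b : Fin (n + 1) → ℝ := j.insertNth 1 fun i => -c i with hb
  set B : Matrix (Fin (n + 1)) (Fin (n + 1)) ℝ := Matrix.updateRow 1 j b with hB
  have hdetB : B.det = 1 := by
    have h1 := Matrix.det_updateRow_sum (1 : Matrix (Fin (n + 1)) (Fin (n + 1)) ℝ) j b
    have h2 : ∑ k, b k • (1 : Matrix (Fin (n + 1)) (Fin (n + 1)) ℝ) k = b := by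
      ext i
      simp [Matrix.one_apply]
    rw [h2] at h1
    rw [hB, h1]
    simp [hb]
  set w' : Fin (n + 1) → H := fun i => ∑ l, B i l • w l with hw'
  have hw'j : w' j = Vᗮ.starProjection (w j) := by
    simp only [hw', hB, Matrix.updateRow_self]
    rw [Fin.sum_univ_succAbove _ j, Submodule.starProjection_orthogonal_val, ← hc]
    simp [hb, sub_eq_add_neg]
  have hw's : ∀ i, w' (j.succAbove i) = w (j.succAbove i) := by
    intro i
    simp [hw', hB, Matrix.one_apply]
  have hdet : (Matrix.gram ℝ w').det = (Matrix.gram ℝ w).det := by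
    rw [hw', gram_sum_smul, Matrix.det_mul, Matrix.det_mul, Matrix.det_transpose, hdetB]
    ring
  rw [← hdet, Matrix.det_succ_row _ j, Finset.sum_eq_single_of_mem j (Finset.mem_univ j)]
  · have h1 : (Matrix.gram ℝ w').submatrix j.succAbove j.succAbove =
        Matrix.gram ℝ fun i => w (j.succAbove i) := by
      ext a b
      simp [hw's]
    rw [h1, Matrix.gram_apply, real_inner_self_eq_norm_sq, hw'j, ← two_mul, pow_mul]
    ring
  · intro l _ hl
    obtain ⟨i, rfl⟩ := Fin.exists_succAbove_eq hl
    have h1 : ⟪w' j, w' (j.succAbove i)⟫_ℝ = 0 := by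
      rw [hw'j, hw's, real_inner_comm]
      exact Submodule.inner_right_of_mem_orthogonal (K := V) (Submodule.subset_span ⟨i, rfl⟩)
        (Submodule.starProjection_apply_mem _ _)
    rw [Matrix.gram_apply, h1]
    ring

theorem det_gram_nonneg {n : ℕ} (w : Fin n → H) : 0 ≤ (Matrix.gram ℝ w).det :=
  (Matrix.posSemidef_gram ℝ w).det_nonneg

theorem measurable_det_gram {α : Type*} [MeasurableSpace α] {n : ℕ} {w : α → Fin n → H}
    (hw : ∀ i, StronglyMeasurable fun a => w a i) :
    Measurable fun a => (Matrix.gram ℝ (w a)).det := by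
  simp_rw [Matrix.det_apply]
  refine Finset.measurable_fun_sum _ fun τ _ => ?_
  refine Measurable.const_smul (Finset.measurable_fun_prod _ fun i _ => ?_) _
  exact ((hw _).inner (hw _)).measurable

/-- The expected Gram determinant of independent samples from `h 0, …, h (n - 1)`. -/
def gramLintegral {n : ℕ} (h : Fin n → Lp H 2 μ) : ℝ≥0∞ :=
  ∫⁻ y, ENNReal.ofReal (Matrix.gram ℝ fun i => h i (y i)).det ∂Measure.pi fun _ => μ

theorem stronglyMeasurable_eval {E : Type*} [NormedAddCommGroup E] {n : ℕ}
    (h : Fin n → Lp E 2 μ) (i : Fin n) :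
    StronglyMeasurable fun y : Fin n → Ω => h i (y i) :=
  (Lp.stronglyMeasurable (h i)).comp_measurable (measurable_pi_apply i)

theorem lintegral_norm_sq (f : Lp H 2 μ) :
    ∫⁻ x, ENNReal.ofReal (‖f x‖ ^ 2) ∂μ = ENNReal.ofReal (‖f‖ ^ 2) := by
  have h1 := L2.integrable_inner (𝕜 := ℝ) f f
  rw [← real_inner_self_eq_norm_sq f, L2.inner_def,
    ofReal_integral_eq_lintegral_ofReal h1 (ae_of_all _ fun x => real_inner_self_nonneg)]
  simp_rw [real_inner_self_eq_norm_sq]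

theorem lintegral_det_gram_insertNth {n : ℕ} (h : Fin (n + 1) → Lp H 2 μ) (j : Fin (n + 1))
    (y : Fin n → Ω) :
    ∫⁻ x, ENNReal.ofReal
        (Matrix.gram ℝ fun i => h i ((j.insertNth x y : Fin (n + 1) → Ω) i)).det ∂μ =
      ENNReal.ofReal (Matrix.gram ℝ fun i => h (j.succAbove i) (y i)).det *
        ENNReal.ofReal (‖(sampleSpan (fun i => h (j.succAbove i) (y i)) id)ᗮ.starProjection.compLp
          (h j)‖ ^ 2) := by
  rw [← lintegral_norm_sq, ← lintegral_const_mul' _ _ ENNReal.ofReal_ne_top]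
  apply lintegral_congr_ae
  filter_upwards [(sampleSpan (fun i => h (j.succAbove i) (y i)) id)ᗮ.starProjection.coeFn_compLp
    (h j)] with x hx
  rw [hx, det_gram_succAbove _ j, ENNReal.ofReal_mul (det_gram_nonneg _)]
  simp

theorem norm_orthogonal_compLp_le (V : Submodule ℝ H) [V.HasOrthogonalProjection]
    (f : Lp H 2 μ) : ‖Vᗮ.starProjection.compLp f‖ ≤ ‖f‖ :=
  (ContinuousLinearMap.norm_compLp_le _ _).trans
    (mul_le_of_le_one_left (norm_nonneg _) (Submodule.starProjection_norm_le _))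

theorem norm_compLp_add_sq {p q : Lp H 2 μ}
    (hpq : ∀ A B : H →L[ℝ] H, ⟪A.compLp p, B.compLp q⟫_ℝ = 0)
    (A : H →L[ℝ] H) : ‖A.compLp (p + q)‖ ^ 2 = ‖A.compLp p‖ ^ 2 + ‖A.compLp q‖ ^ 2 := by
  have : A.compLp (p + q) = A.compLp p + A.compLp q := map_add (A.compLpL 2 μ) p q
  rw [this, norm_add_sq_real, hpq]
  ring

/-- The tuple whose first `j` entries are `p`, the others being `f`. -/
def hybrid {α : Type*} (p f : α) (n j : ℕ) : Fin n → α :=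
  fun i => if (i : ℕ) < j then p else f

theorem hybrid_zero {α : Type*} (p f : α) (n : ℕ) : hybrid p f n 0 = fun _ => f := by
  ext1 i
  simp [hybrid]

theorem hybrid_succ {α : Type*} (p f : α) {n j : ℕ} (hj : j < n) :
    hybrid p f n (j + 1) = Function.update (hybrid p f n j) ⟨j, hj⟩ p := by
  ext1 i
  by_cases h : i = ⟨j, hj⟩
  · subst h
    simp [hybrid]
  · rw [Function.update_of_ne h]
    have : (i : ℕ) ≠ j := fun h' => h (Fin.ext h')
    simp only [hybrid]
    congr 1
    simp only [eq_iff_iff]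
    omega

theorem hybrid_succAbove {α : Type*} (p f : α) {n j : ℕ} (hj : j < n + 1) :
    (fun i => hybrid p f (n + 1) j (Fin.succAbove ⟨j, hj⟩ i)) = hybrid p f n j := by
  ext1 i
  simp only [hybrid]
  congr 1
  simp only [eq_iff_iff, Fin.succAbove, Fin.lt_def]
  split_ifs with h
  · simp at h ⊢
  · simp at h ⊢
    omega

variable [IsFiniteMeasure μ]

theorem gramLintegral_eq {n : ℕ} (h : Fin (n + 1) → Lp H 2 μ) (j : Fin (n + 1)) :
    gramLintegral h = ∫⁻ y, ENNReal.ofReal (Matrix.gram ℝ fun i => h (j.succAbove i) (y i)).det *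
        ENNReal.ofReal (‖(sampleSpan (fun i => h (j.succAbove i) (y i)) id)ᗮ.starProjection.compLp
          (h j)‖ ^ 2) ∂Measure.pi fun _ => μ := by
  have hm := (measurePreserving_piFinSuccAbove (fun _ : Fin (n + 1) => μ) j).symm
  have hmeas : Measurable fun y : Fin (n + 1) → Ω =>
      ENNReal.ofReal (Matrix.gram ℝ fun i => h i (y i)).det :=
    (measurable_det_gram (stronglyMeasurable_eval h)).ennreal_ofReal
  rw [gramLintegral, ← hm.lintegral_comp hmeas, lintegral_prod_symm]
  swap
  · exact (hmeas.comp (MeasurableEquiv.measurable _)).aemeasurable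
  exact lintegral_congr fun y => lintegral_det_gram_insertNth h j y

/-- The projection depends on `y`, so measurability is read off from the inner integral in Tonelli's
theorem. -/
theorem measurable_lintegral_det_gram {n : ℕ} (h : Fin (n + 1) → Lp H 2 μ) (j : Fin (n + 1)) :
    Measurable fun y : Fin n → Ω =>
      ENNReal.ofReal (Matrix.gram ℝ fun i => h (j.succAbove i) (y i)).det *
        ENNReal.ofReal (‖(sampleSpan (fun i => h (j.succAbove i) (y i)) id)ᗮ.starProjection.compLp
          (h j)‖ ^ 2) := by
  simp_rw [← lintegral_det_gram_insertNth]
  have hmeas : Measurable fun y : Fin (n + 1) → Ω =>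
      ENNReal.ofReal (Matrix.gram ℝ fun i => h i (y i)).det :=
    (measurable_det_gram (stronglyMeasurable_eval h)).ennreal_ofReal
  exact (hmeas.comp
    (MeasurableEquiv.piFinSuccAbove (fun _ : Fin (n + 1) => Ω) j).symm.measurable).lintegral_prod_left'

theorem gramLintegral_le_mul {n : ℕ} (h : Fin (n + 1) → Lp H 2 μ) (j : Fin (n + 1)) :
    gramLintegral h ≤
      gramLintegral (fun i => h (j.succAbove i)) * ENNReal.ofReal (‖h j‖ ^ 2) := by
  rw [gramLintegral_eq h j, gramLintegral, ← lintegral_mul_const' _ _ ENNReal.ofReal_ne_top]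
  refine lintegral_mono fun y => ?_
  gcongr
  exact norm_orthogonal_compLp_le _ _

theorem gramLintegral_lt_top {n : ℕ} (h : Fin n → Lp H 2 μ) : gramLintegral h < ∞ := by
  induction n with
  | zero => simp [gramLintegral]
  | succ n ih =>
    exact (gramLintegral_le_mul h 0).trans_lt (ENNReal.mul_lt_top (ih _) ENNReal.ofReal_lt_top)

section Split

variable {n : ℕ} (h : Fin (n + 1) → Lp H 2 μ) (j : Fin (n + 1)) {p q : Lp H 2 μ}

theorem gramLintegral_update_le
    (hpq : ∀ A B : H →L[ℝ] H, ⟪A.compLp p, B.compLp q⟫_ℝ = 0) (hj : h j = p + q) :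
    gramLintegral (Function.update h j p) ≤ gramLintegral h := by
  rw [gramLintegral_eq _ j, gramLintegral_eq h j]
  refine lintegral_mono fun y => ?_
  simp only [Function.update_self, Function.update_of_ne (Fin.succAbove_ne j _)]
  rw [hj, norm_compLp_add_sq hpq]
  gcongr
  exact le_add_of_nonneg_right (sq_nonneg _)

/-- With the other samples fixed, Pythagoras splits the squared height in slot `j` into the parts
from `p` and `q`; the latter is at most `‖q‖²`. -/
theorem gramLintegral_le_update_add
    (hpq : ∀ A B : H →L[ℝ] H, ⟪A.compLp p, B.compLp q⟫_ℝ = 0) (hj : h j = p + q) :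
    gramLintegral h ≤ gramLintegral (Function.update h j p) +
      gramLintegral (fun i => h (j.succAbove i)) * ENNReal.ofReal (‖q‖ ^ 2) := by
  have hmeas : Measurable fun y : Fin n → Ω =>
      ENNReal.ofReal (Matrix.gram ℝ fun i => h (j.succAbove i) (y i)).det *
        ENNReal.ofReal (‖q‖ ^ 2) :=
    (measurable_det_gram (stronglyMeasurable_eval fun i =>
      h (j.succAbove i))).ennreal_ofReal.mul_const _
  rw [gramLintegral_eq h j, gramLintegral_eq (Function.update h j p) j, gramLintegral,
    ← lintegral_mul_const' _ _ ENNReal.ofReal_ne_top, ← lintegral_add_right _ hmeas]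
  refine lintegral_mono fun y => ?_
  simp only [Function.update_self, Function.update_of_ne (Fin.succAbove_ne j _)]
  rw [hj, norm_compLp_add_sq hpq, ENNReal.ofReal_add (sq_nonneg _) (sq_nonneg _), mul_add]
  gcongr
  exact norm_orthogonal_compLp_le _ _

end Split

section Hybrid

variable {f p q : Lp H 2 μ}

theorem gramLintegral_hybrid_le
    (hpq : ∀ A B : H →L[ℝ] H, ⟪A.compLp p, B.compLp q⟫_ℝ = 0) (hf : f = p + q) (n j : ℕ) :
    gramLintegral (hybrid p f n j) ≤ gramLintegral fun _ : Fin n => f := by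
  induction j with
  | zero => rw [hybrid_zero]
  | succ j ih =>
    refine le_trans ?_ ih
    rcases lt_or_ge j n with hj | hj
    · obtain ⟨m, rfl⟩ : ∃ m, n = m + 1 := ⟨n - 1, by omega⟩
      rw [hybrid_succ p f hj]
      exact gramLintegral_update_le _ _ hpq (by simpa [hybrid] using hf)
    · have : hybrid p f n (j + 1) = hybrid p f n j := by
        ext1 i
        have := i.2
        simp only [hybrid]
        rw [if_pos (by omega), if_pos (by omega)]
      rw [this]

/-- Each replacement leaves a cofactor in which some of the `k` remaining slots already hold `p`; by
`gramLintegral_hybrid_le` it is bounded by the integral with `f` in every slot. -/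
theorem gramLintegral_le_hybrid_add
    (hpq : ∀ A B : H →L[ℝ] H, ⟪A.compLp p, B.compLp q⟫_ℝ = 0) (hf : f = p + q) {k j : ℕ}
    (hj : j ≤ k + 1) :
    gramLintegral (fun _ : Fin (k + 1) => f) ≤ gramLintegral (hybrid p f (k + 1) j) +
      j * (gramLintegral (fun _ : Fin k => f) * ENNReal.ofReal (‖q‖ ^ 2)) := by
  induction j with
  | zero => simp [hybrid_zero]
  | succ j ih =>
    have h1 := gramLintegral_le_update_add (hybrid p f (k + 1) j) ⟨j, hj⟩ hpq
      (by simpa [hybrid] using hf)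
    rw [← hybrid_succ, hybrid_succAbove] at h1
    refine (ih (by omega)).trans ?_
    push_cast
    rw [add_mul, one_mul, add_comm (_ * _), ← add_assoc]
    gcongr
    refine h1.trans ?_
    gcongr
    exact gramLintegral_hybrid_le hpq hf k j

end Hybrid

theorem gramLintegral_eq_zero_of_mem {n : ℕ} {U : Submodule ℝ H} [FiniteDimensional ℝ U]
    (hU : Module.finrank ℝ U < n) {p : Lp H 2 μ} (hp : ∀ᵐ x ∂μ, p x ∈ U) :
    gramLintegral (fun _ : Fin n => p) = 0 := by
  rw [gramLintegral, lintegral_eq_zero_iff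
    (measurable_det_gram (stronglyMeasurable_eval fun _ : Fin n => p)).ennreal_ofReal]
  have h1 : ∀ᵐ y ∂Measure.pi fun _ : Fin n => μ, ∀ i, p (y i) ∈ U :=
    ae_all_iff.mpr fun i => (Measure.quasiMeasurePreserving_eval (fun _ : Fin n => μ) i).ae hp
  filter_upwards [h1] with y hy
  have h2 : (Matrix.gram ℝ fun i => p (y i)).det = 0 := by
    by_contra h
    have h3 := finrank_span_eq_card (Matrix.det_gram_ne_zero_iff_linearIndependent.mp h)
    have h4 : Submodule.span ℝ (Set.range fun i => p (y i)) ≤ U :=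
      Submodule.span_le.mpr (by rintro _ ⟨i, rfl⟩; exact hy i)
    have h5 := Submodule.finrank_mono h4
    rw [h3, Fintype.card_fin] at h5
    omega
  simp [h2]

theorem gramLintegral_succ_le [CompleteSpace H] (f : Lp H 2 μ) (k : ℕ) :
    gramLintegral (fun _ : Fin (k + 1) => f) ≤
      gramLintegral (fun _ : Fin k => f) * ENNReal.ofReal ((k + 1) * avgWidth k f ^ 2) := by
  obtain ⟨U, hUf, hUk, hUw, hpq⟩ := exists_optimal_subspace f k
  set p := U.starProjection.compLp f with hp
  set q := Uᗮ.starProjection.compLp f with hq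
  have hf : f = p + q := by
    rw [hq, ← sub_starProjection_compLp]
    abel
  have h1 := gramLintegral_le_hybrid_add hpq hf (k := k) le_rfl
  have h2 : hybrid p f (k + 1) (k + 1) = fun _ => p := by
    ext1 i
    exact if_pos i.2
  have h3 : ∀ᵐ x ∂μ, p x ∈ U := by
    filter_upwards [U.starProjection.coeFn_compLp f] with x hx
    rw [hp, hx]
    exact U.starProjection_apply_mem _
  rw [h2, gramLintegral_eq_zero_of_mem (Nat.lt_succ_of_le hUk) h3, zero_add] at h1
  refine h1.trans ?_
  rw [ENNReal.ofReal_mul (by positivity)]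
  have h4 : ENNReal.ofReal ((k : ℝ) + 1) = ((k + 1 : ℕ) : ℝ≥0∞) := by
    rw [← ENNReal.ofReal_natCast]
    push_cast
    rfl
  rw [h4, mul_left_comm]
  gcongr

end GramIntegral

/-! ### From expected determinants to good samples -/

theorem sampleError_eq {k : ℕ} (f : Lp H 2 μ) (g : Ω → H) (y : Fin k → Ω) :
    sampleError f g y = ‖(sampleSpan g y)ᗮ.starProjection.compLp f‖ := by
  rw [sampleError, sub_starProjection_compLp]

theorem avgWidth_le_sampleError {k : ℕ} (f : Lp H 2 μ) (g : Ω → H) (y : Fin k → Ω) :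
    avgWidth k f ≤ sampleError f g y := by
  rw [sampleError_eq]
  exact avgWidth_le_norm_orthogonal f _ (finrank_sampleSpan_le g y)

theorem sampleError_congr {k : ℕ} (f : Lp H 2 μ) {g g' : Ω → H} {y : Fin k → Ω}
    (h : ∀ i, g (y i) = g' (y i)) : sampleError f g y = sampleError f g' y := by
  have : sampleSpan g y = sampleSpan g' y := by simp only [sampleSpan, h]
  simp only [sampleError_eq, this]

theorem sampleError_eq_zero_of_tail {k : ℕ} {f : Lp H 2 μ} {g : Ω → H} {y : Fin (k + 1) → Ω}
    (h : sampleError f g (Fin.tail y) = 0) : sampleError f g y = 0 := by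
  rw [sampleError_eq, norm_eq_zero] at h ⊢
  have h1 : sampleSpan g (Fin.tail y) ≤ sampleSpan g y :=
    Submodule.span_mono (by rintro _ ⟨i, rfl⟩; exact ⟨i.succ, rfl⟩)
  have h2 : (sampleSpan g y)ᗮ.starProjection.compLp
      ((sampleSpan g (Fin.tail y))ᗮ.starProjection.compLp f) =
      (sampleSpan g y)ᗮ.starProjection.compLp f := by
    rw [compLp_compLp,
      Submodule.starProjection_comp_starProjection_of_le (Submodule.orthogonal_le h1)]
  rw [← h2, h]
  exact map_zero ((sampleSpan g y)ᗮ.starProjection.compLpL 2 μ)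

/-- The Gram determinant of the samples of `f`, in `ℝ≥0∞`. -/
def sampleGram (f : Lp H 2 μ) {k : ℕ} (y : Fin k → Ω) : ℝ≥0∞ :=
  ENNReal.ofReal (Matrix.gram ℝ fun i => f (y i)).det

theorem measurable_sampleGram (f : Lp H 2 μ) {k : ℕ} :
    Measurable fun y : Fin k → Ω => sampleGram f y :=
  (measurable_det_gram (stronglyMeasurable_eval fun _ => f)).ennreal_ofReal

variable [IsFiniteMeasure μ]

theorem measurable_sampleGram_mul (f : Lp H 2 μ) (k : ℕ) :
    Measurable fun y : Fin k → Ω =>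
      sampleGram f y * ENNReal.ofReal (sampleError f f y ^ 2) := by
  simp_rw [sampleError_eq]
  exact measurable_lintegral_det_gram (fun _ : Fin (k + 1) => f) 0

theorem lintegral_sampleGram_mul (f : Lp H 2 μ) (k : ℕ) :
    ∫⁻ y : Fin k → Ω, sampleGram f y * ENNReal.ofReal (sampleError f f y ^ 2)
      ∂Measure.pi (fun _ => μ) = gramLintegral fun _ : Fin (k + 1) => f := by
  simp_rw [sampleError_eq]
  exact (gramLintegral_eq (fun _ : Fin (k + 1) => f) 0).symm

theorem exists_good_set_of_pos [CompleteSpace H] (f : Lp H 2 μ) (k : ℕ)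
    (h0 : gramLintegral (fun _ : Fin k => f) ≠ 0) :
    ∃ S : Set (Fin k → Ω), MeasurableSet S ∧ 0 < Measure.pi (fun _ : Fin k => μ) S ∧
      ∀ y ∈ S, sampleError f f y ^ 2 ≤ (k + 1) * avgWidth k f ^ 2 := by
  set c : ℝ := (k + 1) * avgWidth k f ^ 2 with hc
  have hc0 : 0 ≤ c := by positivity
  set D : (Fin k → Ω) → ℝ≥0∞ := fun y => sampleGram f y with hD
  set E : (Fin k → Ω) → ℝ≥0∞ := fun y =>
    sampleGram f y * ENNReal.ofReal (sampleError f f y ^ 2) with hE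
  have hDm : Measurable D := measurable_sampleGram f
  have hEm : Measurable E := measurable_sampleGram_mul f k
  refine ⟨{y | 0 < D y ∧ E y ≤ D y * ENNReal.ofReal c},
    (measurableSet_lt measurable_const hDm).inter (measurableSet_le hEm (hDm.mul_const _)),
    pos_iff_ne_zero.mpr fun hS => h0 ?_, fun y hy => ?_⟩
  · have h1 : ∀ᵐ y ∂Measure.pi (fun _ : Fin k => μ),
        ¬(0 < D y ∧ E y ≤ D y * ENNReal.ofReal c) := by
      simpa using measure_eq_zero_iff_ae_notMem.mp hS
    -- If the good set were null, this bound and the reverse inequality of finite integrals would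
    -- force equality almost everywhere. Points with `D y > 0` would then be good, so `D` would
    -- vanish almost everywhere.
    have h2 : (fun y => D y * ENNReal.ofReal c) ≤ᵐ[Measure.pi fun _ => μ] E := by
      filter_upwards [h1] with y hy
      by_cases h : 0 < D y
      · exact (not_le.mp fun h' => hy ⟨h, h'⟩).le
      · simp [nonpos_iff_eq_zero.mp (not_lt.mp h)]
    have h3 : ∫⁻ y, D y ∂Measure.pi (fun _ => μ) = gramLintegral fun _ : Fin k => f := rfl
    have h4 : ∫⁻ y, D y * ENNReal.ofReal c ∂Measure.pi (fun _ => μ) =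
        gramLintegral (fun _ : Fin k => f) * ENNReal.ofReal c := by
      rw [lintegral_mul_const _ hDm, h3]
    have h5 := ae_eq_of_ae_le_of_lintegral_le h2
      (by rw [h4]; exact (ENNReal.mul_lt_top (gramLintegral_lt_top _) ENNReal.ofReal_lt_top).ne)
      hEm.aemeasurable
      (by rw [h4, lintegral_sampleGram_mul]; exact gramLintegral_succ_le f k)
    rw [← h3, lintegral_eq_zero_iff hDm]
    filter_upwards [h1, h5] with y hy hy5
    by_contra h
    exact hy ⟨pos_iff_ne_zero.mpr h, hy5.ge⟩
  · have h1 : ENNReal.ofReal (sampleError f f y ^ 2) ≤ ENNReal.ofReal c :=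
      (ENNReal.mul_le_mul_iff_right hy.1.ne' ENNReal.ofReal_ne_top).mp hy.2
    exact (ENNReal.ofReal_le_ofReal_iff hc0).mp h1

theorem exists_exact_set (hμ : 0 < μ Set.univ) (f : Lp H 2 μ) (k : ℕ)
    (h0 : gramLintegral (fun _ : Fin (k + 1) => f) = 0) :
    ∃ S : Set (Fin k → Ω), MeasurableSet S ∧ 0 < Measure.pi (fun _ : Fin k => μ) S ∧
      ∀ᵐ y ∂Measure.pi (fun _ : Fin k => μ), y ∈ S → sampleError f f y = 0 := by
  have base : ∀ k, gramLintegral (fun _ : Fin (k + 1) => f) = 0 →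
      gramLintegral (fun _ : Fin k => f) ≠ 0 →
      ∃ S : Set (Fin k → Ω), MeasurableSet S ∧ 0 < Measure.pi (fun _ : Fin k => μ) S ∧
        ∀ᵐ y ∂Measure.pi (fun _ : Fin k => μ), y ∈ S → sampleError f f y = 0 := by
    intro k h0 h1
    refine ⟨{y | sampleGram f y ≠ 0},
      (measurable_sampleGram f) (measurableSet_singleton (0 : ℝ≥0∞)).compl,
      pos_iff_ne_zero.mpr fun hS => h1 ?_, ?_⟩
    · change ∫⁻ y : Fin k → Ω, sampleGram f y ∂Measure.pi (fun _ => μ) = 0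
      rw [lintegral_eq_zero_iff (measurable_sampleGram f)]
      filter_upwards [measure_eq_zero_iff_ae_notMem.mp hS] with y hy
      exact not_not.mp hy
    · rw [← lintegral_sampleGram_mul, lintegral_eq_zero_iff (measurable_sampleGram_mul f k)] at h0
      filter_upwards [h0] with y hy hyS
      have h2 := (mul_eq_zero.mp hy).resolve_left hyS
      have h3 := ENNReal.ofReal_eq_zero.mp h2
      exact pow_eq_zero_iff two_ne_zero |>.mp (le_antisymm h3 (sq_nonneg _))
  induction k with
  -- The empty Gram determinant is `1` on a one-point space of mass `1`, so the descent stops here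
  -- at the latest.
  | zero => exact base 0 h0 (by simp [gramLintegral])
  | succ k ih =>
    by_cases h1 : gramLintegral (fun _ : Fin (k + 1) => f) = 0
    · obtain ⟨S, hSm, hS, hSf⟩ := ih h1
      have hm := measurePreserving_piFinSuccAbove (fun _ : Fin (k + 1) => μ) 0
      have ht : ∀ y : Fin (k + 1) → Ω,
          (MeasurableEquiv.piFinSuccAbove (fun _ : Fin (k + 1) => Ω) 0 y).2 = Fin.tail y :=
        fun y => rfl
      -- The tail already reproduces `f`, so the first sample is free; positivity of `μ Set.univ`
      -- keeps the measure of the product positive.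
      refine ⟨MeasurableEquiv.piFinSuccAbove (fun _ : Fin (k + 1) => Ω) 0 ⁻¹' (Set.univ ×ˢ S),
        hm.measurable (MeasurableSet.univ.prod hSm), ?_, ?_⟩
      · rw [hm.measure_preimage (MeasurableSet.univ.prod hSm).nullMeasurableSet,
          Measure.prod_prod]
        exact ENNReal.mul_pos hμ.ne' hS.ne'
      · have h2 := (Measure.quasiMeasurePreserving_snd.comp hm.quasiMeasurePreserving).ae hSf
        filter_upwards [h2] with y hy hyS
        exact sampleError_eq_zero_of_tail (hy hyS.2)
    · exact base (k + 1) h0 h1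

theorem exists_good_set [CompleteSpace H] (hμ : 0 < μ Set.univ) (f : Lp H 2 μ) (k : ℕ) :
    ∃ S : Set (Fin k → Ω), MeasurableSet S ∧ 0 < Measure.pi (fun _ : Fin k => μ) S ∧
      ∀ᵐ y ∂Measure.pi (fun _ : Fin k => μ), y ∈ S →
        sampleError f f y ^ 2 ≤ (k + 1) * avgWidth k f ^ 2 := by
  by_cases h0 : gramLintegral (fun _ : Fin k => f) = 0
  · obtain ⟨S, hSm, hS, hSf⟩ := exists_exact_set hμ f k (by
      have := gramLintegral_succ_le f k
      rw [h0, zero_mul] at this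
      exact nonpos_iff_eq_zero.mp this)
    refine ⟨S, hSm, hS, ?_⟩
    filter_upwards [hSf] with y hy hyS
    rw [hy hyS, zero_pow two_ne_zero]
    positivity
  · obtain ⟨S, hSm, hS, hSf⟩ := exists_good_set_of_pos f k h0
    exact ⟨S, hSm, hS, ae_of_all _ hSf⟩

end

theorem theorem1 {Ω : Type*} [MeasurableSpace Ω] (μ : Measure Ω) [IsFiniteMeasure μ]
    (hμ : 0 < μ Set.univ)
    {H : Type*} [NormedAddCommGroup H] [InnerProductSpace ℝ H] [CompleteSpace H]
    (f : Lp H 2 μ) (k : ℕ) :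
    -- the singular values of `f` exist, and their tail is the squared width
    (∃ σ : ℕ → ℝ, IsSingularValueSequence f σ) ∧
    (∀ σ : ℕ → ℝ, IsSingularValueSequence f σ →
      HasSum (fun i : ℕ => σ (k + i) ^ 2) (avgWidth k f ^ 2)) ∧
    -- one measurable set of sample tuples that serves every representative `g` of `f`
    ∃ S : Set (Fin k → Ω), MeasurableSet S ∧ 0 < Measure.pi (fun _ : Fin k => μ) S ∧
      ∀ g : Ω → H, g =ᵐ[μ] f →
        ∀ᵐ y ∂(Measure.pi fun _ : Fin k => μ), y ∈ S →
          avgWidth k f ≤ sampleError f g y ∧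
          sampleError f g y ≤ Real.sqrt (k + 1) * avgWidth k f ∧
          ∀ σ : ℕ → ℝ, IsSingularValueSequence f σ →
            sampleError f g y ^ 2 ≤ (k + 1) * ∑' i : ℕ, σ (k + i) ^ 2 := by
  refine ⟨exists_isSingularValueSequence f, fun σ hσ => hσ.hasSum_tail k, ?_⟩
  obtain ⟨S, hSm, hS, hSf⟩ := exists_good_set hμ f k
  refine ⟨S, hSm, hS, fun g hg => ?_⟩
  -- `S` was built from one fixed representative; passing to `g` enlarges only the exceptional null
  -- set.
  have h1 : ∀ᵐ y ∂Measure.pi fun _ : Fin k => μ, ∀ i, g (y i) = f (y i) :=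
    ae_all_iff.mpr fun i => (Measure.quasiMeasurePreserving_eval (fun _ : Fin k => μ) i).ae hg
  filter_upwards [h1, hSf] with y hy hyf hyS
  have h2 := hyf hyS
  rw [← sampleError_congr f hy] at h2
  refine ⟨avgWidth_le_sampleError f g y, ?_, fun σ hσ => ?_⟩
  · refine le_of_sq_le_sq ?_ ?_
    · rw [mul_pow, Real.sq_sqrt (by positivity)]
      exact h2
    · exact mul_nonneg (Real.sqrt_nonneg _) (avgWidth_nonneg k f)
  · rwa [(hσ.hasSum_tail k).tsum_eq]
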